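/- **Theorem 5 (Second Fundamental Theorem).** Let $I$ be a (possibly infinite) totally ordered set and $h\in\mathbb C$. Let $H_I=H_I(h)$ be the unital associative $\mathbb C$-algebra generated by $x_i,y_i$ ($i\in I$) with relations $x_iy_i=y_ix_i+hy_i^2$ for all $i\in I$, and, for $i<j$, $$x_jy_i=y_ix_j+hy_iy_j,\quad y_jx_i=x_iy_j-hy_iy_j,\quad y_jy_i=y_iy_j,\quad x_jx_i=x_ix_j-hx_iy_j+hy_ix_j+h^2y_iy_j.$$ Let $E,F,H$ be the linear operators on $H_I$ that vanish on $1$ and are determined by $$Ex_i=0,\ Ey_i=x_i,\quad Fx_i=y_i,\ Fy_i=0,\quad Hx_i=x_i,\ Hy_i=-y_i,$$ $$E(ab)=E(a)\,e^{-hF}(b)+e^{hF}(a)\,E(b),\quad F(ab)=F(a)b+aF(b),\quad H(ab)=H(a)\,e^{-hF}(b)+e^{hF}(a)\,H(b),$$ and let $H_I^{Inv}=\{v\in H_I: E(v)=F(v)=H(v)=0\}$, a subalgebra of $H_I$. For $i,j\in I$ put $(ij)=x_iy_j-y_ix_j-hy_iy_j$; these elements lie in $H_I^{Inv}$ and commute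 with each other. Let $B_I$ be the commutative polynomial algebra over $\mathbb C$ in independent symbols $[ij]$, $(i,j)\in I\times I$, and let $g_h:B_I\to H_I^{Inv}(h)$ be the algebra homomorphism with $g_h([ij])=(ij)$. If $h\ne0$, then $\ker g_h$ is the ideal of $B_I$ generated by all elements $$[ij]+[ji]\quad\text{and}\quad [ij][kl]+[ik][lj]+[il][jk]\qquad(i,j,k,l\in I),$$ and $\ker g_h=\ker g_0$, i.e. an identity between bracket symbols holds for $h$ if and only if it holds in the classical case $h=0$. -/

import Mathlib

/-- The generators `x i`, `y i` (`i ∈ I`) of the free algebra `A_I`. -/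
inductive Gen (I : Type*) where
  | x : I → Gen I
  | y : I → Gen I

/-- The map on generators with `x i ↦ u i` and `y i ↦ v i`. -/
def Gen.val {I B : Type*} (u v : I → B) : Gen I → B
  | .x i => u i
  | .y i => v i

namespace BraidedLine

/-- The free complex unital algebra `A_I` on the variables `x i`, `y i`. -/
abbrev A (I : Type*) : Type _ := FreeAlgebra ℂ (Gen I)

/-- The variable `x i` of the free algebra. -/
noncomputable def ax {I : Type*} (i : I) : A I := FreeAlgebra.ι ℂ (Gen.x i)

/-- The variable `y i` of the free algebra. -/
noncomputable def ay {I : Type*} (i : I) : A I := FreeAlgebra.ι ℂ (Gen.y i)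

/-- The defining relations of `H_I`: one relation for every `i`, four for every pair `i < j`. -/
inductive Rel (h : ℂ) {I : Type*} [LinearOrder I] : A I → A I → Prop
  | xy_self (i : I) : Rel h (ax i * ay i) (ay i * ax i + h • (ay i * ay i))
  | xy {i j : I} (hij : i < j) : Rel h (ax j * ay i) (ay i * ax j + h • (ay i * ay j))
  | yx {i j : I} (hij : i < j) : Rel h (ay j * ax i) (ax i * ay j - h • (ay i * ay j))
  | yy {i j : I} (hij : i < j) : Rel h (ay j * ay i) (ay i * ay j)
  | xx {i j : I} (hij : i < j) : Rel h (ax j * ax i)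
      (ax i * ax j - h • (ax i * ay j) + h • (ay i * ax j) + h ^ 2 • (ay i * ay j))

/-- The algebra `H_I = A_I / J` of noncommutative homogeneous coordinates, with parameter `h`. -/
def HAlg (h : ℂ) (I : Type*) [LinearOrder I] : Type _ := RingQuot (Rel h (I := I))

noncomputable instance (h : ℂ) (I : Type*) [LinearOrder I] : Ring (HAlg h I) :=
  inferInstanceAs (Ring (RingQuot (Rel h (I := I))))

noncomputable instance (h : ℂ) (I : Type*) [LinearOrder I] : Algebra ℂ (HAlg h I) :=
  inferInstanceAs (Algebra ℂ (RingQuot (Rel h (I := I))))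

/-- The quotient map `A_I → H_I`. -/
noncomputable def proj (h : ℂ) (I : Type*) [LinearOrder I] : A I →ₐ[ℂ] HAlg h I :=
  RingQuot.mkAlgHom ℂ (Rel h (I := I))

theorem proj_rel {h : ℂ} {I : Type*} [LinearOrder I] {a b : A I} (r : Rel h a b) :
    proj h I a = proj h I b :=
  RingQuot.mkAlgHom_rel ℂ r

section

variable {h : ℂ} {I : Type*} [LinearOrder I]

/-- The coordinate `x i` in `H_I`. -/
noncomputable def X (h : ℂ) {I : Type*} [LinearOrder I] (i : I) : HAlg h I :=
  proj h I (ax i)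

/-- The coordinate `y i` in `H_I`. -/
noncomputable def Y (h : ℂ) {I : Type*} [LinearOrder I] (i : I) : HAlg h I :=
  proj h I (ay i)

theorem xy_self_rel (i : I) : X h i * Y h i = Y h i * X h i + h • (Y h i * Y h i) := by
  simpa [X, Y] using proj_rel (Rel.xy_self (h := h) i)

theorem yy_comm (i j : I) : Y h j * Y h i = Y h i * Y h j := by
  rcases lt_trichotomy i j with hij | rfl | hij
  · simpa [X, Y] using proj_rel (Rel.yy (h := h) hij)
  · rfl
  · simpa [X, Y] using (proj_rel (Rel.yy (h := h) hij)).symm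

theorem xy_comm (i j : I) : X h j * Y h i = Y h i * X h j + h • (Y h i * Y h j) := by
  rcases lt_trichotomy i j with hij | rfl | hij
  · simpa [X, Y] using proj_rel (Rel.xy (h := h) hij)
  · exact xy_self_rel i
  · have : Y h i * X h j = X h j * Y h i - h • (Y h j * Y h i) := by
      simpa [X, Y] using proj_rel (Rel.yx (h := h) hij)
    rw [this, yy_comm i j]; abel

theorem xx_comm_aux {i j : I} (hij : i < j) :
    X h j * X h i = X h i * X h j + h • (Y h i * X h j - Y h j * X h i) := by
  have := proj_rel (Rel.xx (h := h) hij)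
  simp only [map_add, map_sub, map_mul, map_smul] at this
  change X h j * X h i = X h i * X h j - h • (X h i * Y h j) + h • (Y h i * X h j)
    + h ^ 2 • (Y h i * Y h j) at this
  rw [this, xy_comm j i, yy_comm i j]
  module

theorem xx_comm (i j : I) :
    X h j * X h i = X h i * X h j + h • (Y h i * X h j - Y h j * X h i) := by
  rcases lt_trichotomy i j with hij | rfl | hij
  · exact xx_comm_aux hij
  · simp
  · rw [xx_comm_aux hij]; module

/-- Algebra homomorphisms out of `H_I`. -/
noncomputable def lift {B : Type*} [Ring B] [Algebra ℂ B] (u v : I → B)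
    (hyy : ∀ i j, v j * v i = v i * v j)
    (hxy : ∀ i j, u j * v i = v i * u j + h • (v i * v j))
    (hxx : ∀ i j, u j * u i = u i * u j + h • (v i * u j - v j * u i)) :
    HAlg h I →ₐ[ℂ] B :=
  RingQuot.liftAlgHom ℂ ⟨FreeAlgebra.lift ℂ (Gen.val u v), by
    intro a b r
    cases r with
    | xy_self i => simpa [ax, ay, Gen.val] using hxy i i
    | xy _ => simpa [ax, ay, Gen.val] using hxy _ _
    | @yx i j _ => simp [ax, ay, Gen.val, hxy j i, hyy i j]
    | yy _ => simpa [ax, ay, Gen.val] using hyy _ _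
    | @xx i j _ => 
      simp only [ax, ay, map_add, map_sub, map_mul, map_smul, FreeAlgebra.lift_ι_apply, Gen.val]
      rw [hxx i j, hxy j i, hyy i j]
      module⟩

@[simp] theorem lift_X {B : Type*} [Ring B] [Algebra ℂ B] (u v : I → B) (hyy) (hxy) (hxx) (i : I) :
    lift (h := h) u v hyy hxy hxx (X h i) = u i := by
  simp only [lift, X, ax, proj]
  exact (RingQuot.liftAlgHom_mkAlgHom_apply ..).trans (by simp [Gen.val])

@[simp] theorem lift_Y {B : Type*} [Ring B] [Algebra ℂ B] (u v : I → B) (hyy) (hxy) (hxx) (i : I) :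
    lift (h := h) u v hyy hxy hxx (Y h i) = v i := by
  simp only [lift, Y, ay, proj]
  exact (RingQuot.liftAlgHom_mkAlgHom_apply ..).trans (by simp [Gen.val])

end

/-! The action of the generators `E`, `F`, `H` of the quantum group on `H_I`. A linear map `D` with
`D (a * b) = D a * τ b + σ a * D b`, for algebra endomorphisms `σ` and `τ`, is the same as an algebra
homomorphism `a ↦ !![σ a, D a; 0, τ a]`; this is how the three operators are constructed. -/

/-- The exponential `e^{cF}` as an operator on `H_I`. Since `F` is a derivation with
`F (x i) = y i` and `F (y i) = 0`, this is the algebra endomorphism with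
`x i ↦ x i + c y i` and `y i ↦ y i`; see `expF_eq_sum`. -/
noncomputable def expF (h c : ℂ) (I : Type*) [LinearOrder I] : HAlg h I →ₐ[ℂ] HAlg h I :=
  lift (fun i => X h i + c • Y h i) (fun i => Y h i)
    (fun i j => yy_comm i j)
    (fun i j => by simp only [add_mul, mul_add, smul_mul_assoc, mul_smul_comm, xy_comm i j,
      yy_comm i j]; module)
    (fun i j => by
      simp only [add_mul, mul_add, smul_mul_assoc, mul_smul_comm, xx_comm i j, xy_comm i j,
        xy_comm j i, yy_comm i j]; module)

/-- The matrix form `a ↦ !![a, F a; 0, a]` of the action of `F`. -/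
noncomputable def matF (h : ℂ) (I : Type*) [LinearOrder I] : HAlg h I →ₐ[ℂ] Matrix (Fin 2) (Fin 2) (HAlg h I) :=
  lift (fun i => !![X h i, Y h i; 0, X h i]) (fun i => !![Y h i, 0; 0, Y h i])
    (fun i j => by
      ext a b; fin_cases a <;> fin_cases b <;>
      simp [Matrix.mul_apply, Fin.sum_univ_two, yy_comm i j])
    (fun i j => by
      ext a b; fin_cases a <;> fin_cases b <;>
      simp [Matrix.mul_apply, Fin.sum_univ_two, yy_comm i j, xy_comm i j])
    (fun i j => by
      ext a b; fin_cases a <;> fin_cases b <;>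
      simp [Matrix.mul_apply, Fin.sum_univ_two, yy_comm i j, xy_comm i j, xy_comm j i,
        xx_comm i j] <;> module)

/-- The matrix form `a ↦ !![e^{hF} a, E a; 0, e^{-hF} a]` of the action of `E`. -/
noncomputable def matE (h : ℂ) (I : Type*) [LinearOrder I] : HAlg h I →ₐ[ℂ] Matrix (Fin 2) (Fin 2) (HAlg h I) :=
  lift (fun i => !![X h i + h • Y h i, 0; 0, X h i - h • Y h i])
    (fun i => !![Y h i, X h i; 0, Y h i])
    (fun i j => by
      ext a b; fin_cases a <;> fin_cases b <;>
      simp [Matrix.mul_apply, Fin.sum_univ_two, yy_comm i j, xy_comm i j, xy_comm j i,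
        xx_comm i j] <;> module)
    (fun i j => by
      ext a b; fin_cases a <;> fin_cases b <;>
      simp [Matrix.mul_apply, Fin.sum_univ_two, yy_comm i j, xy_comm i j, xy_comm j i,
        xx_comm i j, add_mul, mul_add, sub_mul, mul_sub] <;> module)
    (fun i j => by
      ext a b; fin_cases a <;> fin_cases b <;>
      simp [Matrix.mul_apply, Fin.sum_univ_two, yy_comm i j, xy_comm i j, xy_comm j i,
        xx_comm i j, add_mul, mul_add, sub_mul, mul_sub] <;> module)

/-- The matrix form `a ↦ !![e^{hF} a, H a; 0, e^{-hF} a]` of the action of `H`. -/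
noncomputable def matH (h : ℂ) (I : Type*) [LinearOrder I] : HAlg h I →ₐ[ℂ] Matrix (Fin 2) (Fin 2) (HAlg h I) :=
  lift (fun i => !![X h i + h • Y h i, X h i; 0, X h i - h • Y h i])
    (fun i => !![Y h i, -Y h i; 0, Y h i])
    (fun i j => by
      ext a b; fin_cases a <;> fin_cases b <;>
      simp [Matrix.mul_apply, Fin.sum_univ_two, yy_comm i j, xy_comm i j, xy_comm j i,
        xx_comm i j])
    (fun i j => by
      ext a b; fin_cases a <;> fin_cases b <;>
      simp [Matrix.mul_apply, Fin.sum_univ_two, yy_comm i j, xy_comm i j, xy_comm j i,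
        xx_comm i j, add_mul, mul_add, sub_mul, mul_sub] <;> module)
    (fun i j => by
      ext a b; fin_cases a <;> fin_cases b <;>
      simp [Matrix.mul_apply, Fin.sum_univ_two, yy_comm i j, xy_comm i j, xy_comm j i,
        xx_comm i j, add_mul, mul_add, sub_mul, mul_sub] <;> module)

/-- The action of `E` on `H_I`. -/
noncomputable def opE (h : ℂ) (I : Type*) [LinearOrder I] : HAlg h I →ₗ[ℂ] HAlg h I :=
  Matrix.entryLinearMap ℂ (HAlg h I) 0 1 ∘ₗ (matE h I).toLinearMap

/-- The action of `F` on `H_I`. -/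
noncomputable def opF (h : ℂ) (I : Type*) [LinearOrder I] : HAlg h I →ₗ[ℂ] HAlg h I :=
  Matrix.entryLinearMap ℂ (HAlg h I) 0 1 ∘ₗ (matF h I).toLinearMap

/-- The action of `H` on `H_I`. -/
noncomputable def opH (h : ℂ) (I : Type*) [LinearOrder I] : HAlg h I →ₗ[ℂ] HAlg h I :=
  Matrix.entryLinearMap ℂ (HAlg h I) 0 1 ∘ₗ (matH h I).toLinearMap

section

variable {h : ℂ} {I : Type*} [LinearOrder I]

/-- `H_I` is generated by the coordinates. -/
theorem induction {P : HAlg h I → Prop} (hX : ∀ i, P (X h i)) (hY : ∀ i, P (Y h i))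
    (hc : ∀ c : ℂ, P (algebraMap ℂ _ c)) (hadd : ∀ a b, P a → P b → P (a + b))
    (hmul : ∀ a b, P a → P b → P (a * b)) (a : HAlg h I) : P a := by
  obtain ⟨b, rfl⟩ := RingQuot.mkAlgHom_surjective ℂ (Rel h (I := I)) a
  change P (proj h I b)
  induction b using FreeAlgebra.induction with
  | grade0 c => simpa using hc c
  | grade1 g => cases g with
    | x i => exact hX i
    | y i => exact hY i
  | mul a b ha hb => simpa using hmul _ _ ha hb
  | add a b ha hb => simpa using hadd _ _ ha hb

@[simp] theorem expF_X (c : ℂ) (i : I) : expF h c I (X h i) = X h i + c • Y h i := by simp [expF]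
@[simp] theorem expF_Y (c : ℂ) (i : I) : expF h c I (Y h i) = Y h i := by simp [expF]
@[simp] theorem opE_X (i : I) : opE h I (X h i) = 0 := by simp [opE, matE]
@[simp] theorem opE_Y (i : I) : opE h I (Y h i) = X h i := by simp [opE, matE]
@[simp] theorem opE_algebraMap (c : ℂ) : opE h I (algebraMap ℂ _ c) = 0 := by
  simp [opE, Matrix.algebraMap_matrix_apply]
@[simp] theorem opF_X (i : I) : opF h I (X h i) = Y h i := by simp [opF, matF]
@[simp] theorem opF_Y (i : I) : opF h I (Y h i) = 0 := by simp [opF, matF]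
@[simp] theorem opF_algebraMap (c : ℂ) : opF h I (algebraMap ℂ _ c) = 0 := by
  simp [opF, Matrix.algebraMap_matrix_apply]
@[simp] theorem opH_X (i : I) : opH h I (X h i) = X h i := by simp [opH, matH]
@[simp] theorem opH_Y (i : I) : opH h I (Y h i) = -Y h i := by simp [opH, matH]
@[simp] theorem opH_algebraMap (c : ℂ) : opH h I (algebraMap ℂ _ c) = 0 := by
  simp [opH, Matrix.algebraMap_matrix_apply]

theorem matE_diag (a : HAlg h I) : matE h I a 0 0 = expF h h I a ∧ matE h I a 1 0 = 0 ∧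
    matE h I a 1 1 = expF h (-h) I a := by
  induction a using induction with
  | hX i => simp [matE, sub_eq_add_neg]
  | hY i => simp [matE]
  | hc c => simp [Matrix.algebraMap_matrix_apply]
  | hadd a b ha hb => simp [ha, hb]
  | hmul a b ha hb => simp [Matrix.mul_apply, Fin.sum_univ_two, ha, hb]

theorem matH_diag (a : HAlg h I) : matH h I a 0 0 = expF h h I a ∧ matH h I a 1 0 = 0 ∧
    matH h I a 1 1 = expF h (-h) I a := by
  induction a using induction with
  | hX i => simp [matH, sub_eq_add_neg]
  | hY i => simp [matH]
  | hc c => simp [Matrix.algebraMap_matrix_apply]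
  | hadd a b ha hb => simp [ha, hb]
  | hmul a b ha hb => simp [Matrix.mul_apply, Fin.sum_univ_two, ha, hb]

theorem matF_diag (a : HAlg h I) : matF h I a 0 0 = a ∧ matF h I a 1 0 = 0 ∧
    matF h I a 1 1 = a := by
  induction a using induction with
  | hX i => simp [matF]
  | hY i => simp [matF]
  | hc c => simp [Matrix.algebraMap_matrix_apply]
  | hadd a b ha hb => simp [ha, hb]
  | hmul a b ha hb => simp [Matrix.mul_apply, Fin.sum_univ_two, ha, hb]

theorem opE_mul (a b : HAlg h I) :
    opE h I (a * b) = opE h I a * expF h (-h) I b + expF h h I a * opE h I b := by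
  simp [opE, Matrix.mul_apply, Fin.sum_univ_two, matE_diag, add_comm]

theorem opF_mul (a b : HAlg h I) : opF h I (a * b) = opF h I a * b + a * opF h I b := by
  simp [opF, Matrix.mul_apply, Fin.sum_univ_two, matF_diag, add_comm]

theorem opH_mul (a b : HAlg h I) :
    opH h I (a * b) = opH h I a * expF h (-h) I b + expF h h I a * opH h I b := by
  simp [opH, Matrix.mul_apply, Fin.sum_univ_two, matH_diag, add_comm]

open Polynomial in
/-- The generating function of the operators `F ^ n / n!`. -/
noncomputable def genF (h : ℂ) (I : Type*) [LinearOrder I] : HAlg h I →ₐ[ℂ] (HAlg h I)[X] :=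
  lift (fun i => C (X h i) + C (Y h i) * Polynomial.X) (fun i => C (Y h i))
    (fun i j => by rw [← C_mul, yy_comm i j, C_mul])
    (fun i j => by
      simp only [add_mul, mul_add, mul_assoc, X_mul_C, ← C_mul, xy_comm i j, yy_comm i j, C_add,
        ← smul_C]
      simp only [← mul_assoc, ← C_mul, yy_comm i j]
      module)
    (fun i j => by
      simp only [add_mul, mul_add, mul_assoc, X_mul]
      simp only [← mul_assoc, ← C_mul, xx_comm i j, xy_comm i j, xy_comm j i, yy_comm i j, C_add,
        C_sub, ← smul_C, add_mul, smul_mul_assoc]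
      module)

open Polynomial in
theorem derivative_genF (a : HAlg h I) :
    derivative (genF h I a) = genF h I (opF h I a) := by
  induction a using induction with
  | hX i => simp [genF]
  | hY i => simp [genF]
  | hc c => simp [Polynomial.algebraMap_apply]
  | hadd a b ha hb => simp [ha, hb]
  | hmul a b ha hb => simp [opF_mul, ha, hb]

open Polynomial in
theorem eval_genF (c : ℂ) (a : HAlg h I) :
    (genF h I a).eval (algebraMap ℂ _ c) = expF h c I a := by
  have hmul (p q : (HAlg h I)[X]) : (p * q).eval (algebraMap ℂ _ c) =
      p.eval (algebraMap ℂ _ c) * q.eval (algebraMap ℂ _ c) :=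
    eval₂_mul_noncomm _ _ fun k => (Algebra.commutes c _).symm
  induction a using induction with
  | hX i => simp [genF, hmul, Algebra.smul_def, Algebra.commutes]
  | hY i => simp [genF]
  | hc c => simp [Polynomial.algebraMap_apply]
  | hadd a b ha hb => simp [ha, hb]
  | hmul a b ha hb => simp [hmul, ha, hb]

theorem coeff_genF (n : ℕ) (a : HAlg h I) :
    (n.factorial : ℂ) • (genF h I a).coeff n = (opF h I ^ n) a := by
  induction n generalizing a with
  | zero =>
    have := eval_genF 0 a
    have h0 : expF h 0 I a = a := by
      induction a using induction with
      | hX i => simp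
      | hY i => simp
      | hc c => simp
      | hadd a b ha hb => simp [ha (eval_genF 0 a), hb (eval_genF 0 b)]
      | hmul a b ha hb => simp [ha (eval_genF 0 a), hb (eval_genF 0 b)]
    rw [h0, map_zero, ← Polynomial.coeff_zero_eq_eval_zero] at this
    simp [this]
  | succ n ih =>
    rw [pow_succ, Module.End.mul_apply, ← ih, ← derivative_genF, Polynomial.coeff_derivative,
      Nat.factorial_succ, Nat.cast_mul, mul_comm, mul_smul]
    congr 1
    rw [Algebra.smul_def, Algebra.commutes]
    simp

/-- `F` is locally nilpotent on `H_I`, and `expF h c I` is the exponential of `c F`. -/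
theorem expF_eq_sum (c : ℂ) (a : HAlg h I) : ∃ N : ℕ, (∀ n ≥ N, (opF h I ^ n) a = 0) ∧
    expF h c I a = ∑ n ∈ Finset.range N, (c ^ n / (n.factorial : ℂ)) • (opF h I ^ n) a := by
  refine ⟨(genF h I a).natDegree + 1, fun n hn => ?_, ?_⟩
  · rw [← coeff_genF, Polynomial.coeff_eq_zero_of_natDegree_lt hn, smul_zero]
  · rw [← eval_genF, Polynomial.eval_eq_sum_range]
    refine Finset.sum_congr rfl fun n _ => ?_
    rw [← coeff_genF, smul_smul, div_mul_cancel₀ _ (by exact_mod_cast n.factorial_ne_zero),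
      ← map_pow, ← Algebra.commutes, Algebra.smul_def]

end

/-- The subalgebra `H_I^{Inv}` of invariant elements: those killed by `E`, `F` and `H`. -/
noncomputable def Inv (h : ℂ) (I : Type*) [LinearOrder I] : Subalgebra ℂ (HAlg h I) where
  carrier := {v | opE h I v = 0 ∧ opF h I v = 0 ∧ opH h I v = 0}
  mul_mem' {a b} ha hb := by
    obtain ⟨h1, h2, h3⟩ := ha
    obtain ⟨h4, h5, h6⟩ := hb
    simp [opE_mul, opF_mul, opH_mul, h1, h2, h3, h4, h5, h6]
  add_mem' {a b} ha hb := by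
    obtain ⟨h1, h2, h3⟩ := ha
    obtain ⟨h4, h5, h6⟩ := hb
    simp [h1, h2, h3, h4, h5, h6]
  algebraMap_mem' c := by simp

/-- The bracket symbol `(ij) = x i y j - y i x j - h y i y j` in `H_I`. -/
noncomputable def bracket (h : ℂ) {I : Type*} [LinearOrder I] (i j : I) : HAlg h I :=
  X h i * Y h j - Y h i * X h j - h • (Y h i * Y h j)

section

variable {h : ℂ} {I : Type*} [LinearOrder I]

theorem bracket_mem (i j : I) : bracket h i j ∈ Inv h I := by
  refine ⟨?_, ?_, ?_⟩
  · simp [bracket, opE_mul, add_mul, mul_add]; module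
  · simp [bracket, opF_mul]
  · simp [bracket, opH_mul, add_mul, mul_add]; module

theorem bracket_comm_Y (i j k : I) : bracket h i j * Y h k = Y h k * bracket h i j := by
  have e1 : X h i * Y h j * Y h k = Y h k * X h i * Y h j + h • (Y h k * Y h i * Y h j) := by
    rw [mul_assoc, yy_comm k j, ← mul_assoc, xy_comm k i, add_mul, smul_mul_assoc]
  have e2 : Y h i * X h j * Y h k = Y h k * Y h i * X h j + h • (Y h k * Y h i * Y h j) := by
    rw [mul_assoc, xy_comm k j, mul_add, mul_smul_comm, ← mul_assoc, ← mul_assoc, yy_comm k i]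
  have e3 : Y h i * Y h j * Y h k = Y h k * Y h i * Y h j := by
    rw [mul_assoc, yy_comm k j, ← mul_assoc, yy_comm k i]
  simp only [bracket, sub_mul, mul_sub, smul_mul_assoc, mul_smul_comm, e1, e2, e3, ← mul_assoc]
  module

theorem bracket_eq (i j : I) : bracket h i j = Y h j * X h i - Y h i * X h j := by
  rw [bracket, xy_comm j i, yy_comm i j]; module

theorem bracket_comm_X (i j k : I) : bracket h i j * X h k = X h k * bracket h i j := by
  have e1 (i j : I) : X h k * Y h j * X h i =
      Y h j * X h i * X h k + h • (Y h j * Y h i * X h k - Y h j * Y h k * X h i)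
        + h • (Y h j * Y h k * X h i) := by
    rw [xy_comm j k, add_mul, smul_mul_assoc, mul_assoc, xx_comm i k]
    simp only [mul_add, mul_sub, mul_smul_comm, ← mul_assoc]
  rw [bracket_eq]
  simp only [sub_mul, mul_sub, ← mul_assoc, e1, yy_comm i j]
  module

/-- The bracket symbols are central in `H_I`. -/
theorem bracket_central (i j : I) (a : HAlg h I) : bracket h i j * a = a * bracket h i j := by
  induction a using induction with
  | hX k => exact bracket_comm_X i j k
  | hY k => exact bracket_comm_Y i j k
  | hc c => exact (Algebra.commutes c _).symm
  | hadd a b ha hb => rw [mul_add, add_mul, ha, hb]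
  | hmul a b ha hb => rw [← mul_assoc, ha, mul_assoc, hb, mul_assoc]

end

/-- The bracket symbol `(ij)`, `p = (i, j)`, as an element of `H_I^{Inv}`. -/
noncomputable def invBracket (h : ℂ) {I : Type*} [LinearOrder I] (p : I × I) : Inv h I :=
  ⟨bracket h p.1 p.2, bracket_mem p.1 p.2⟩

/-- The subalgebra `S_I ⊆ H_I^{Inv}` generated by the bracket symbols. -/
noncomputable def S (h : ℂ) (I : Type*) [LinearOrder I] : Subalgebra ℂ (Inv h I) :=
  Algebra.adjoin ℂ (Set.range (invBracket h (I := I)))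

/-- `S_I` is commutative. -/
instance (h : ℂ) (I : Type*) [LinearOrder I] : IsMulCommutative (S h I) :=
  Algebra.isMulCommutative_adjoin ℂ (s := Set.range (invBracket h (I := I))) (by
    rintro _ ⟨p, rfl⟩ _ ⟨q, rfl⟩
    exact Subtype.ext (bracket_central p.1 p.2 (bracket h q.1 q.2)))

/-- The algebra `B_I` of polynomials over `ℂ` in the free commuting symbols `[ij]`, for all pairs
`(i, j)` with `i, j ∈ I`. -/
abbrev B (I : Type*) : Type _ := MvPolynomial (I × I) ℂ

/-- The free symbol `[ij]`. -/
noncomputable def sym {I : Type*} (i j : I) : B I := MvPolynomial.X (i, j)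

open scoped IsMulCommutative in
/-- The algebra homomorphism `g_h : B_I → H_I^{Inv}` with `[ij] ↦ (ij)`; it evaluates an expression
in bracket symbols. -/
noncomputable def g (h : ℂ) (I : Type*) [LinearOrder I] : B I →ₐ[ℂ] Inv h I :=
  (S h I).val.comp (MvPolynomial.aeval fun p : I × I =>
    (⟨invBracket h p, Algebra.subset_adjoin ⟨p, rfl⟩⟩ : S h I))

open scoped IsMulCommutative in
theorem g_sym (h : ℂ) {I : Type*} [LinearOrder I] (i j : I) :
    (g h I (sym i j) : HAlg h I) = bracket h i j := by
  simp [g, sym, invBracket]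

/-- The generators `[ij] + [ji]` and `[ij][kl] + [ik][lj] + [il][jk]`, for all indices, of the
classical ideal of syzygies. -/
def syzygies (I : Type*) : Set (B I) :=
  {e | ∃ i j : I, e = sym i j + sym j i} ∪
    {e | ∃ i j k l : I, e = sym i j * sym k l + sym i k * sym l j + sym i l * sym j k}

end BraidedLine

/-! For every value of `h`, zero included, the kernel is caught in a cycle of inclusions: syzygy
ideal ≤ ker g_h ≤ kernel of the classical evaluation ≤ syzygy ideal. Both claims follow.

The first inclusion is a computation in H_I. The brackets are central and satisfy the cyclic
identities Σ y_j (kl) = 0 and Σ x_j (kl) = 0; since (ij) = y_j x_i - y_i x_j, these combine to the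
Plücker relation (`bracket_pluecker`).

The second needs no basis of H_I. It suffices that H_I acts on ℂ[x, y] with y_i acting by
multiplication and x_i as x_i + h y_i θ, where θ is the derivation with θ x = -x and θ y = y; these
signs are what the relations demand. In a bracket the θ-terms cancel, so (ij) acts as multiplication
by the classical bracket (`classicalAction_g`).

The third is the classical theorem. Over `Fin n`, straightening shows that standard products span
modulo the syzygies (`standardSpace_eq_top`), and distinct leading monomials make their classical
values independent (`linearIndependent_standard`). An arbitrary index set reduces to this one
because a polynomial involves finitely many indices. -/

namespace BraidedLine

open MvPolynomial hiding X

/-! ### The classical bracket algebra -/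

/-- The ring of classical coordinates; `Sum.inlₗ i` stands for `x i` and `Sum.inrₗ i` for `y i`. -/
abbrev Coord (I : Type*) : Type _ := MvPolynomial (I ⊕ₗ I) ℂ

/-- The classical coordinate `x i`. -/
noncomputable def cx {I : Type*} (i : I) : Coord I := MvPolynomial.X (Sum.inlₗ i)

/-- The classical coordinate `y i`. -/
noncomputable def cy {I : Type*} (i : I) : Coord I := MvPolynomial.X (Sum.inrₗ i)

/-- Evaluation of a bracket expression in the classical coordinates. -/
noncomputable def evalClassical (I : Type*) : B I →ₐ[ℂ] Coord I :=
  aeval fun p : I × I => cx p.1 * cy p.2 - cy p.1 * cx p.2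

@[simp] theorem evalClassical_X {I : Type*} (p : I × I) :
    evalClassical I (MvPolynomial.X p) = cx p.1 * cy p.2 - cy p.1 * cx p.2 := by
  simp [evalClassical]

/-! ### The action of `H_I` on classical coordinates -/

/-- The derivation `x i ↦ -x i`, `y i ↦ y i`. -/
noncomputable def theta (I : Type*) : Derivation ℂ (Coord I) (Coord I) :=
  mkDerivation ℂ fun s => Sum.elim (fun i => -cx i) (fun i => cy i) (ofLex s)

@[simp] theorem theta_cx {I : Type*} (i : I) : theta I (cx i) = -cx i := by
  simp only [theta, cx, mkDerivation_X]; rfl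

@[simp] theorem theta_cy {I : Type*} (i : I) : theta I (cy i) = cy i := by
  simp only [theta, cy, mkDerivation_X]; rfl

/-- The action of `H_I` on the classical coordinate ring in which `x i` acts as `x i + h y i θ` and
`y i` as multiplication by `y i`. -/
noncomputable def classicalAction (h : ℂ) (I : Type*) [LinearOrder I] :
    HAlg h I →ₐ[ℂ] Module.End ℂ (Coord I) :=
  lift (fun i => LinearMap.mulLeft ℂ (cx i) +
      h • (LinearMap.mulLeft ℂ (cy i) ∘ₗ (theta I : Coord I →ₗ[ℂ] Coord I)))
    (fun i => LinearMap.mulLeft ℂ (cy i))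
    (fun i j => LinearMap.ext fun f => by
      simp only [Module.End.mul_apply, LinearMap.mulLeft_apply]; ring)
    (fun i j => LinearMap.ext fun f => by
      simp [smul_eq_C_mul]; ring)
    (fun i j => LinearMap.ext fun f => by
      simp [smul_eq_C_mul]; ring)

/-- In y_j x_i - y_i x_j the θ-terms are h y_j y_i θ and h y_i y_j θ, which cancel. -/
theorem classicalAction_bracket (h : ℂ) {I : Type*} [LinearOrder I] (i j : I) :
    classicalAction h I (bracket h i j) =
      LinearMap.mulLeft ℂ (cx i * cy j - cy i * cx j) := by
  rw [bracket_eq]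
  refine LinearMap.ext fun f => ?_
  simp [classicalAction, smul_eq_C_mul]; ring

theorem classicalAction_g (h : ℂ) {I : Type*} [LinearOrder I] (p : B I) :
    classicalAction h I (g h I p) = LinearMap.mulLeft ℂ (evalClassical I p) := by
  have : ((classicalAction h I).comp (Inv h I).val).comp (g h I) =
      (Algebra.lmul ℂ (Coord I)).comp (evalClassical I) := by
    refine algHom_ext fun q => ?_
    have := classicalAction_bracket h q.1 q.2
    rw [← g_sym] at this
    refine LinearMap.ext fun f => ?_
    simpa [sym, sub_mul] using DFunLike.congr_fun this f
  exact DFunLike.congr_fun this p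

theorem ker_g_le_ker_evalClassical (h : ℂ) (I : Type*) [LinearOrder I] :
    RingHom.ker (g h I) ≤ RingHom.ker (evalClassical I) := by
  intro p hp
  -- A multiplication operator is recovered from its value at 1.
  have := congr($(classicalAction_g h p) 1)
  rw [RingHom.mem_ker] at hp ⊢
  simpa [hp] using this.symm

/-! ### The syzygies hold in `H_I` -/

theorem bracket_antisymm (h : ℂ) {I : Type*} [LinearOrder I] (i j : I) :
    bracket h i j + bracket h j i = 0 := by
  rw [bracket_eq, bracket_eq]; abel

theorem Y_bracket_cyclic (h : ℂ) {I : Type*} [LinearOrder I] (j k l : I) :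
    Y h j * bracket h k l + Y h k * bracket h l j + Y h l * bracket h j k = 0 := by
  simp only [bracket_eq, mul_sub, ← mul_assoc, yy_comm k j, yy_comm l j, yy_comm l k]
  abel

/-- With the central brackets moved to the left, the sum becomes y_l [x_k, x_j] + y_k [x_j, x_l] +
y_j [x_l, x_k]. Each commutator is h times a difference of terms y x, and the resulting terms y y x
cancel in pairs. -/
theorem X_bracket_cyclic (h : ℂ) {I : Type*} [LinearOrder I] (j k l : I) :
    X h j * bracket h k l + X h k * bracket h l j + X h l * bracket h j k = 0 := by
  simp only [← bracket_central]
  simp only [bracket_eq, sub_mul, mul_assoc, xx_comm j k, xx_comm j l, xx_comm k l]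
  simp only [mul_add, mul_sub, mul_smul_comm, ← mul_assoc, yy_comm k j, yy_comm l j, yy_comm l k]
  module

/-- Expanding the first factor of each product as y_j x_i - y_i x_j turns the left side into (Σ y_j
(kl)) x_i - y_i (Σ x_j (kl)), and both cyclic sums vanish. -/
theorem bracket_pluecker (h : ℂ) {I : Type*} [LinearOrder I] (i j k l : I) :
    bracket h i j * bracket h k l + bracket h i k * bracket h l j
      + bracket h i l * bracket h j k = 0 := by
  have hX := congr(Y h i * $(X_bracket_cyclic h j k l))
  have hY := congr($(Y_bracket_cyclic h j k l) * X h i)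
  simp only [mul_add, add_mul, mul_zero, zero_mul, mul_assoc, bracket_comm_X] at hX hY
  rw [bracket_eq i j, bracket_eq i k, bracket_eq i l]
  simp only [sub_mul, mul_assoc]
  -- The right side is written as 0 - 0, so that each zero can be replaced by one of the two cyclic
  -- identities.
  rw [← sub_zero (0 : HAlg h I)]
  nth_rewrite 1 [← hY]
  rw [← hX]
  abel

theorem span_syzygies_le_ker_g (h : ℂ) (I : Type*) [LinearOrder I] :
    Ideal.span (syzygies I) ≤ RingHom.ker (g h I) := by
  rw [Ideal.span_le]
  rintro e (⟨i, j, rfl⟩ | ⟨i, j, k, l, rfl⟩) <;> rw [SetLike.mem_coe, RingHom.mem_ker] <;>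
    apply Subtype.ext
  · simpa [g_sym] using bracket_antisymm h i j
  · simpa [g_sym] using bracket_pluecker h i j k l

/-! ### Straightening -/

/-- The product of the bracket symbols in a multiset of pairs. -/
noncomputable def symProd {I : Type*} (s : Multiset (I × I)) : B I := (s.map MvPolynomial.X).prod

@[simp] theorem symProd_zero {I : Type*} : symProd (0 : Multiset (I × I)) = 1 := by simp [symProd]

@[simp] theorem symProd_cons {I : Type*} (p : I × I) (s : Multiset (I × I)) :
    symProd (p ::ₘ s) = MvPolynomial.X p * symProd s := by simp [symProd]

/-- A multiset of pairs is standard if it consists of increasing pairs, no two of which are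
strictly nested. -/
def IsStandard {I : Type*} [LinearOrder I] (s : Multiset (I × I)) : Prop :=
  (∀ p ∈ s, p.1 < p.2) ∧ ∀ p ∈ s, ∀ q ∈ s, p.1 < q.1 → p.2 ≤ q.2

/-- The quantity that decreases in a straightening step. -/
def weight {n : ℕ} (s : Multiset (Fin n × Fin n)) : ℕ :=
  (s.map fun p => ((p.2 : ℕ) - (p.1 : ℕ)) ^ 2).sum

theorem weight_cons {n : ℕ} (p : Fin n × Fin n) (s : Multiset (Fin n × Fin n)) :
    weight (p ::ₘ s) = ((p.2 : ℕ) - (p.1 : ℕ)) ^ 2 + weight s := by simp [weight]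

theorem antisymm_mem_span {I : Type*} (i j : I) :
    sym i j + sym j i ∈ Ideal.span (syzygies I) :=
  Ideal.subset_span (Or.inl ⟨i, j, rfl⟩)

theorem sym_self_mem_span {I : Type*} (i : I) : sym i i ∈ Ideal.span (syzygies I) := by
  have := (Ideal.span (syzygies I)).mul_mem_left (C (1 / 2 : ℂ)) (antisymm_mem_span i i)
  rwa [← two_mul, ← mul_assoc, show (2 : B I) = C 2 from (map_ofNat C 2).symm, ← C_mul,
    one_div_mul_cancel two_ne_zero, C_1, one_mul] at this

theorem unnest_mem_span {I : Type*} (i j k l : I) :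
    sym i l * sym j k - (sym i k * sym j l - sym i j * sym k l) ∈ Ideal.span (syzygies I) := by
  have h1 : sym i j * sym k l + sym i k * sym l j + sym i l * sym j k ∈
    Ideal.span (syzygies I) := Ideal.subset_span (Or.inr ⟨i, j, k, l, rfl⟩)
  have h2 := (Ideal.span (syzygies I)).mul_mem_left (sym i k) (antisymm_mem_span j l)
  convert sub_mem h1 h2 using 1
  ring

/-- The complex subspace spanned by the ideal of syzygies and the standard products. -/
noncomputable def standardSpace (I : Type*) [LinearOrder I] : Submodule ℂ (B I) :=
  (Ideal.span (syzygies I)).restrictScalars ℂ ⊔ Submodule.span ℂ (symProd '' {s | IsStandard s})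

theorem span_syzygies_le_standardSpace {I : Type*} [LinearOrder I] {p : B I}
    (hp : p ∈ Ideal.span (syzygies I)) : p ∈ standardSpace I :=
  Submodule.mem_sup_left (by simpa using hp)

/-- Crossing pairs have the same total length as nested ones but more balanced lengths, hence a
smaller sum of squares; disjoint pairs are shorter altogether. -/
theorem unnest_weight_lt {i j k l : ℕ} (hij : i < j) (hjk : j < k) (hkl : k < l) :
    (k - i) ^ 2 + (l - j) ^ 2 < (l - i) ^ 2 + (k - j) ^ 2 ∧
      (j - i) ^ 2 + (l - k) ^ 2 < (l - i) ^ 2 + (k - j) ^ 2 := by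
  obtain ⟨a, rfl⟩ := Nat.exists_eq_add_of_lt hij
  obtain ⟨b, rfl⟩ := Nat.exists_eq_add_of_lt hjk
  obtain ⟨c, rfl⟩ := Nat.exists_eq_add_of_lt hkl
  -- The gaps are a + 1, b + 1, c + 1; this removes the truncated subtractions.
  rw [show i + a + 1 + b + 1 - i = a + b + 2 by omega,
    show i + a + 1 + b + 1 + c + 1 - (i + a + 1) = b + c + 2 by omega,
    show i + a + 1 + b + 1 + c + 1 - i = a + b + c + 3 by omega,
    show i + a + 1 + b + 1 - (i + a + 1) = b + 1 by omega,
    show i + a + 1 - i = a + 1 by omega,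
    show i + a + 1 + b + 1 + c + 1 - (i + a + 1 + b + 1) = c + 1 by omega]
  constructor <;> ring_nf <;> nlinarith [Nat.zero_le (a * c), Nat.zero_le (a * b),
    Nat.zero_le (b * c)]

/-- A nested pair [il][jk] is replaced by [ik][jl] - [ij][kl] modulo the ideal. Both new products
have smaller weight, so the process terminates. -/
theorem symProd_mem_standardSpace_of_lt {n : ℕ} (s : Multiset (Fin n × Fin n))
    (hs : ∀ p ∈ s, p.1 < p.2) : symProd s ∈ standardSpace (Fin n) := by
  induction hw : weight s using Nat.strong_induction_on generalizing s with
  | _ w ih =>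
  by_cases hstd : IsStandard s
  · exact Submodule.mem_sup_right (Submodule.subset_span ⟨s, hstd, rfl⟩)
  obtain ⟨p, hp, q, hq, hpq, hqp⟩ : ∃ p ∈ s, ∃ q ∈ s, p.1 < q.1 ∧ q.2 < p.2 := by
    by_contra! hcon
    exact hstd ⟨hs, hcon⟩
  obtain ⟨t, rfl⟩ := Multiset.exists_cons_of_mem hp
  have hqt : q ∈ t := by
    rcases Multiset.mem_cons.1 hq with rfl | h
    · exact absurd hpq (lt_irrefl _)
    · exact h
  obtain ⟨t, rfl⟩ := Multiset.exists_cons_of_mem hqt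
  obtain ⟨i, l⟩ := p
  obtain ⟨j, k⟩ := q
  have hjk : j < k := hs (j, k) (by simp)
  simp only at hpq hqp
  obtain ⟨hw1, hw2⟩ := unnest_weight_lt (Fin.lt_def.1 hpq) (Fin.lt_def.1 hjk) (Fin.lt_def.1 hqp)
  have ht : ∀ p ∈ t, p.1 < p.2 := fun p hp => hs p (by simp [hp])
  simp only [weight_cons] at hw
  have h1 := ih (weight ((i, k) ::ₘ (j, l) ::ₘ t)) (by simp only [weight_cons]; omega)
    ((i, k) ::ₘ (j, l) ::ₘ t) (by
      simpa [or_imp, forall_and] using ⟨hpq.trans hjk, hjk.trans hqp, by simpa using ht⟩) rfl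
  have h2 := ih (weight ((i, j) ::ₘ (k, l) ::ₘ t)) (by simp only [weight_cons]; omega)
    ((i, j) ::ₘ (k, l) ::ₘ t) (by
      simpa [or_imp, forall_and] using ⟨hpq, hqp, by simpa using ht⟩) rfl
  have h3 := span_syzygies_le_standardSpace
    ((Ideal.span (syzygies (Fin n))).mul_mem_right (symProd t) (unnest_mem_span i j k l))
  convert add_mem h3 (sub_mem h1 h2) using 1
  simp only [symProd_cons, sym]
  ring

/-- Antisymmetry reorients each symbol at the cost of a sign and kills the symbols [ii]. -/
theorem exists_symProd_of_lt {I : Type*} [LinearOrder I] (s : Multiset (I × I)) :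
    ∃ (c : ℂ) (t : Multiset (I × I)), (∀ p ∈ t, p.1 < p.2) ∧
      symProd s - C c * symProd t ∈ Ideal.span (syzygies I) := by
  induction s using Multiset.induction_on with
  | empty => exact ⟨1, 0, by simp, by simp⟩
  | cons p s ih =>
    obtain ⟨c, t, ht, h⟩ := ih
    obtain ⟨i, j⟩ := p
    have h1 := (Ideal.span (syzygies I)).mul_mem_left (sym i j) h
    rcases lt_trichotomy i j with hij | rfl | hij
    · refine ⟨c, (i, j) ::ₘ t, by simpa using ⟨hij, by simpa using ht⟩, ?_⟩
      convert h1 using 1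
      simp only [symProd_cons, sym]; ring
    · refine ⟨0, 0, by simp, ?_⟩
      simpa [sym] using (Ideal.span (syzygies I)).mul_mem_right (symProd s) (sym_self_mem_span i)
    · refine ⟨-c, (j, i) ::ₘ t, by simpa using ⟨hij, by simpa using ht⟩, ?_⟩
      have h2 := (Ideal.span (syzygies I)).mul_mem_right (C c * symProd t) (antisymm_mem_span i j)
      convert add_mem h1 h2 using 1
      simp only [symProd_cons, sym, map_neg]; ring

theorem symProd_mem_standardSpace {n : ℕ} (s : Multiset (Fin n × Fin n)) :
    symProd s ∈ standardSpace (Fin n) := by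
  obtain ⟨c, t, ht, h⟩ := exists_symProd_of_lt s
  have h1 := (standardSpace (Fin n)).smul_mem c (symProd_mem_standardSpace_of_lt t ht)
  simpa [smul_eq_C_mul] using add_mem (span_syzygies_le_standardSpace h) h1

theorem mem_span_range_symProd {I : Type*} (p : B I) :
    p ∈ Submodule.span ℂ (Set.range (symProd (I := I))) := by
  induction p using MvPolynomial.induction_on with
  | C a =>
    have h1 : (1 : B I) ∈ Submodule.span ℂ (Set.range (symProd (I := I))) :=
      Submodule.subset_span ⟨0, symProd_zero⟩
    simpa [smul_eq_C_mul] using Submodule.smul_mem _ a h1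
  | add p q hp hq => exact add_mem hp hq
  | mul_X p i hp =>
    induction hp using Submodule.span_induction with
    | mem _ h =>
      obtain ⟨s, rfl⟩ := h
      exact Submodule.subset_span ⟨i ::ₘ s, by rw [symProd_cons, mul_comm]⟩
    | zero => simp
    | add a b _ _ ha hb => rw [add_mul]; exact add_mem ha hb
    | smul c a _ ha => rw [smul_mul_assoc]; exact Submodule.smul_mem _ c ha

theorem standardSpace_eq_top (n : ℕ) : standardSpace (Fin n) = ⊤ := by
  refine eq_top_iff.2 fun p _ => ?_
  refine Submodule.span_le.2 ?_ (mem_span_range_symProd p)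
  rintro _ ⟨s, rfl⟩
  exact symProd_mem_standardSpace s

/-! ### Standard products are determined by their leading monomials -/

theorem IsStandard.exists_sorted {I : Type*} [LinearOrder I] {s : Multiset (I × I)}
    (hs : IsStandard s) : ∃ l : List (I × I), (l : Multiset (I × I)) = s ∧
      (l.map Prod.fst).Pairwise (· ≤ ·) ∧ (l.map Prod.snd).Pairwise (· ≤ ·) := by
  obtain ⟨l, rfl, hl⟩ : ∃ l : List (I × I), (l : Multiset (I × I)) = s ∧
      l.Pairwise (fun p q => toLex p ≤ toLex q) := by
    refine ⟨(((s.map toLex).sort).map ofLex), ?_, ?_⟩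
    · rw [← Multiset.map_coe, Multiset.sort_eq, Multiset.map_map]; exact Multiset.map_id s
    · rw [List.pairwise_map]; exact Multiset.pairwise_sort (s.map toLex) (· ≤ ·)
  refine ⟨l, rfl, ?_, ?_⟩ <;> rw [List.pairwise_map] <;> refine hl.imp_of_mem ?_ <;>
    intro p q hp hq hpq <;> rw [Prod.Lex.toLex_le_toLex] at hpq
  · exact hpq.elim le_of_lt fun h => h.1.le
  · exact hpq.elim (hs.2 p hp q hq) fun h => h.2

/-- Non-nesting means that sorting lexicographically sorts both coordinates at once, so the pairs
are recovered by zipping the sorted first entries with the sorted second entries. -/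
theorem IsStandard.ext {I : Type*} [LinearOrder I] {s t : Multiset (I × I)}
    (hs : IsStandard s) (ht : IsStandard t) (h1 : s.map Prod.fst = t.map Prod.fst)
    (h2 : s.map Prod.snd = t.map Prod.snd) : s = t := by
  obtain ⟨l, rfl, hl1, hl2⟩ := hs.exists_sorted
  obtain ⟨m, rfl, hm1, hm2⟩ := ht.exists_sorted
  simp only [Multiset.map_coe, Multiset.coe_eq_coe] at h1 h2
  have e1 := h1.eq_of_pairwise' hl1 hm1
  have e2 := h2.eq_of_pairwise' hl2 hm2
  rw [List.zip_of_prod (xs := l) rfl rfl, List.zip_of_prod (xs := m) rfl rfl, e1, e2]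

/-- The leading exponent of the classical value of the symbol `[ij]` with `i < j`. -/
noncomputable def leadExp {I : Type*} (p : I × I) : (I ⊕ₗ I) →₀ ℕ :=
  Finsupp.single (Sum.inlₗ p.1) 1 + Finsupp.single (Sum.inrₗ p.2) 1

/-- The exponents first differ at x_i, which occurs only in x_i y_j. -/
theorem leadExp_swap_lt {I : Type*} [LinearOrder I] {i j : I} (hij : i < j) :
    toLex (leadExp (j, i)) < toLex (leadExp (i, j)) := by
  classical
  rw [Finsupp.Lex.lt_iff]
  refine ⟨Sum.inlₗ i, fun s hs => ?_, ?_⟩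
  · have h1 : (Sum.inlₗ i : I ⊕ₗ I) ≠ s := hs.ne'
    have h2 : (Sum.inlₗ j : I ⊕ₗ I) ≠ s := (hs.trans (Sum.Lex.inl_lt_inl_iff.2 hij)).ne'
    have h3 : ∀ a, (Sum.inrₗ a : I ⊕ₗ I) ≠ s := fun a =>
      (hs.trans (Sum.Lex.inl_lt_inr i a)).ne'
    simp [leadExp, h1, h2, h3]
  · have h2 : (Sum.inlₗ j : I ⊕ₗ I) ≠ Sum.inlₗ i := (Sum.Lex.inl_lt_inl_iff.2 hij).ne'
    simp [leadExp, h2]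

instance {α β : Type*} [Finite α] [Finite β] : Finite (α ⊕ₗ β) :=
  inferInstanceAs (Finite (α ⊕ β))

theorem degree_cx_mul_cy {I : Type*} [LinearOrder I] [Finite I] (i j : I) :
    (MonomialOrder.lex (σ := I ⊕ₗ I)).degree (cx i * cy j : Coord I) = leadExp (i, j) := by
  rw [MonomialOrder.degree_mul (by simp [cx]) (by simp [cy])]
  simp [cx, cy, MonomialOrder.degree_X, leadExp]

theorem degree_evalClassical_X {I : Type*} [LinearOrder I] [Finite I] {p : I × I}
    (hp : p.1 < p.2) : evalClassical I (MvPolynomial.X p) ≠ 0 ∧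
      (MonomialOrder.lex (σ := I ⊕ₗ I)).degree (evalClassical I (MvPolynomial.X p)) = leadExp p := by
  have h : (MonomialOrder.lex (σ := I ⊕ₗ I)).degree (evalClassical I (MvPolynomial.X p)) = leadExp p := by
    rw [evalClassical_X, mul_comm (cy p.1), MonomialOrder.degree_sub_of_lt, degree_cx_mul_cy]
    rw [degree_cx_mul_cy, degree_cx_mul_cy]
    exact leadExp_swap_lt hp
  refine ⟨fun h0 => ?_, h⟩
  rw [h0, MonomialOrder.degree_zero] at h
  -- The zero polynomial has degree 0, whereas `leadExp p` is nonzero at the x-variable of `p.1`.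
  simpa [leadExp] using congr($h (Sum.inlₗ p.1))

theorem degree_evalClassical_symProd {I : Type*} [LinearOrder I] [Finite I]
    (s : Multiset (I × I)) (hs : ∀ p ∈ s, p.1 < p.2) : evalClassical I (symProd s) ≠ 0 ∧
      (MonomialOrder.lex (σ := I ⊕ₗ I)).degree (evalClassical I (symProd s)) =
        (s.map leadExp).sum := by
  induction s using Multiset.induction_on with
  | empty => simp
  | cons p s ih =>
    obtain ⟨h1, h2⟩ := ih fun q hq => hs q (by simp [hq])
    obtain ⟨h3, h4⟩ := degree_evalClassical_X (hs p (by simp))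
    rw [symProd_cons, map_mul]
    refine ⟨mul_ne_zero h3 h1, ?_⟩
    rw [MonomialOrder.degree_mul h3 h1, h2, h4, Multiset.map_cons, Multiset.sum_cons]

theorem toMultiset_sum_leadExp {I : Type*} (s : Multiset (I × I)) :
    Finsupp.toMultiset (s.map leadExp).sum =
      (s.map Prod.fst).map Sum.inlₗ + (s.map Prod.snd).map Sum.inrₗ := by
  induction s using Multiset.induction_on with
  | empty => simp
  | cons p s ih =>
    simp only [Multiset.map_cons, Multiset.sum_cons, map_add, ih, leadExp, Finsupp.toMultiset_single,
      one_nsmul]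
    simp only [← Multiset.singleton_add]
    abel

theorem filterMap_const_none {α β : Type*} (s : Multiset α) :
    s.filterMap (fun _ => (none : Option β)) = 0 := by
  induction s using Multiset.induction_on <;> simp_all

theorem map_inl_add_map_inr_injective {α : Type*} {s s' t t' : Multiset α}
    (h : s.map (Sum.inlₗ : α → α ⊕ₗ α) + t.map Sum.inrₗ = s'.map Sum.inlₗ + t'.map Sum.inrₗ) :
    s = s' ∧ t = t' := by
  have hl := congr(($h).filterMap fun a => (ofLex a).getLeft?)
  have hr := congr(($h).filterMap fun a => (ofLex a).getRight?)
  simp only [Multiset.filterMap_add, Multiset.filterMap_map] at hl hr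
  simpa [Function.comp_def, Sum.inlₗ, Sum.inrₗ, filterMap_const_none] using And.intro hl hr

theorem IsStandard.ext_leadExp {I : Type*} [LinearOrder I] {s t : Multiset (I × I)}
    (hs : IsStandard s) (ht : IsStandard t)
    (h : (s.map leadExp).sum = (t.map leadExp).sum) : s = t := by
  replace h := congrArg Finsupp.toMultiset h
  rw [toMultiset_sum_leadExp, toMultiset_sum_leadExp] at h
  obtain ⟨h1, h2⟩ := map_inl_add_map_inr_injective h
  exact hs.ext ht h1 h2

/-- In a nontrivial relation, the largest leading monomial comes from a single term and cannot
cancel. -/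
theorem linearIndependent_of_degree_injective {σ ι R : Type*} [Field R] (m : MonomialOrder σ)
    {f : ι → MvPolynomial σ R} (hf : ∀ i, f i ≠ 0)
    (hinj : Function.Injective fun i => m.degree (f i)) : LinearIndependent R f := by
  rw [linearIndependent_iff]
  intro l hl
  by_contra hne
  obtain ⟨i, hi, hmax⟩ := l.support.exists_max_image (fun i => m.toSyn (m.degree (f i)))
    (Finsupp.support_nonempty_iff.2 hne)
  have := congr(coeff (m.degree (f i)) $hl)
  rw [Finsupp.linearCombination_apply, Finsupp.sum, coeff_sum, coeff_zero,
    Finset.sum_eq_single_of_mem i hi] at this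
  · rw [coeff_smul, smul_eq_zero, m.coeff_degree_eq_zero_iff] at this
    exact this.elim (Finsupp.mem_support_iff.1 hi) (hf i)
  · intro j hj hji
    rw [coeff_smul, m.coeff_eq_zero_of_lt, smul_zero]
    exact lt_of_le_of_ne (hmax j hj) fun h => hji (hinj (m.toSyn.injective h))

theorem linearIndependent_standard (I : Type*) [LinearOrder I] [Finite I] :
    LinearIndependent ℂ fun s : {s : Multiset (I × I) // IsStandard s} =>
      evalClassical I (symProd s.1) := by
  refine linearIndependent_of_degree_injective (MonomialOrder.lex (σ := I ⊕ₗ I))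
    (fun s => (degree_evalClassical_symProd s.1 s.2.1).1) fun s t hst => Subtype.ext ?_
  refine s.2.ext_leadExp t.2 ?_
  rwa [← (degree_evalClassical_symProd s.1 s.2.1).2, ← (degree_evalClassical_symProd t.1 t.2.1).2]

/-! ### The classical second fundamental theorem -/

theorem evalClassical_eq_zero_of_mem_span {I : Type*} {p : B I}
    (hp : p ∈ Ideal.span (syzygies I)) : evalClassical I p = 0 := by
  suffices Ideal.span (syzygies I) ≤ RingHom.ker (evalClassical I) from this hp
  rw [Ideal.span_le]
  rintro e (⟨i, j, rfl⟩ | ⟨i, j, k, l, rfl⟩) <;> rw [SetLike.mem_coe, RingHom.mem_ker] <;>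
    simp only [sym, map_add, map_mul, evalClassical_X] <;> ring

/-- Modulo the ideal, `p` is a combination of standard products; its classical value vanishes, so
independence forces every coefficient to be zero. -/
theorem mem_span_of_evalClassical_fin {n : ℕ} {p : B (Fin n)}
    (hp : evalClassical (Fin n) p = 0) : p ∈ Ideal.span (syzygies (Fin n)) := by
  have hmem : p ∈ standardSpace (Fin n) := by rw [standardSpace_eq_top]; trivial
  obtain ⟨a, ha, b, hb, rfl⟩ := Submodule.mem_sup.1 hmem
  replace ha : a ∈ Ideal.span (syzygies (Fin n)) := by simpa using ha
  rw [map_add, evalClassical_eq_zero_of_mem_span ha, zero_add] at hp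
  rw [Set.image_eq_range, ← Finsupp.range_linearCombination] at hb
  obtain ⟨l, rfl⟩ := hb
  have hl := linearIndependent_iff.1 (linearIndependent_standard (Fin n)) l (by
    rw [← hp, ← AlgHom.toLinearMap_apply, Finsupp.apply_linearCombination]; rfl)
  have hl' : l = 0 := hl
  simpa [hl'] using ha

/-! ### Change of index set and reduction to finitely many indices -/

theorem rename_mem_span_syzygies {I J : Type*} (f : I → J) {p : B I}
    (hp : p ∈ Ideal.span (syzygies I)) :
    rename (Prod.map f f) p ∈ Ideal.span (syzygies J) := by
  suffices Ideal.span (syzygies I) ≤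
    (Ideal.span (syzygies J)).comap (rename (R := ℂ) (Prod.map f f)) from this hp
  rw [Ideal.span_le]
  rintro e (⟨i, j, rfl⟩ | ⟨i, j, k, l, rfl⟩)
  · exact Ideal.subset_span (Or.inl ⟨f i, f j, by simp [sym]⟩)
  · exact Ideal.subset_span (Or.inr ⟨f i, f j, f k, f l, by simp [sym]⟩)

theorem evalClassical_rename {I J : Type*} (f : I → J) (p : B I) :
    evalClassical J (rename (Prod.map f f) p) =
      rename (fun s => toLex (Sum.map f f (ofLex s))) (evalClassical I p) := by
  have : (evalClassical J).comp (rename (Prod.map f f)) =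
      (rename fun s : I ⊕ₗ I => toLex (Sum.map f f (ofLex s))).comp (evalClassical I) := by
    refine algHom_ext fun q => ?_
    simp [cx, cy, Sum.inlₗ, Sum.inrₗ]
  exact DFunLike.congr_fun this p

theorem exists_finset_rename_prod {I : Type*} (p : B I) :
    ∃ (s : Finset I) (q : B s), p = rename (Prod.map (↑) (↑)) q := by
  classical
  obtain ⟨t, q, rfl⟩ := exists_finset_rename p
  refine ⟨t.image Prod.fst ∪ t.image Prod.snd, rename (fun x =>
    (⟨x.1.1, Finset.mem_union_left _ (Finset.mem_image_of_mem _ x.2)⟩,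
      ⟨x.1.2, Finset.mem_union_right _ (Finset.mem_image_of_mem _ x.2)⟩)) q, ?_⟩
  rw [rename_rename]; rfl

/-- The classical second fundamental theorem for brackets on the line. -/
theorem ker_evalClassical_le (I : Type*) :
    RingHom.ker (evalClassical I) ≤ Ideal.span (syzygies I) := by
  intro p hp
  rw [RingHom.mem_ker] at hp
  obtain ⟨s, q, rfl⟩ := exists_finset_rename_prod p
  apply rename_mem_span_syzygies
  have hinj : Function.Injective
      (fun a : s ⊕ₗ s => toLex (Sum.map ((↑) : s → I) ((↑) : s → I) (ofLex a))) :=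
    toLex.injective.comp ((Subtype.val_injective.sumMap Subtype.val_injective).comp ofLex.injective)
  rw [evalClassical_rename, map_eq_zero_iff _ (rename_injective _ hinj)] at hp
  -- Any enumeration will do: neither the syzygies nor the classical evaluation depends on an order
  -- of the indices.
  let e := s.equivFin
  have := rename_mem_span_syzygies e.symm (mem_span_of_evalClassical_fin
    (p := rename (Prod.map e e) q) (by rw [evalClassical_rename, hp, map_zero]))
  rw [rename_rename, Prod.map_comp_map, e.symm_comp_self, Prod.map_id] at this
  simpa using this

theorem ker_g_eq_span (h : ℂ) (I : Type*) [LinearOrder I] :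
    RingHom.ker (g h I) = Ideal.span (syzygies I) :=
  le_antisymm ((ker_g_le_ker_evalClassical h I).trans (ker_evalClassical_le I))
    (span_syzygies_le_ker_g h I)

end BraidedLine

theorem theorem5 (I : Type*) [LinearOrder I] (h : ℂ) (hh : h ≠ 0) :
    RingHom.ker (BraidedLine.g h I) = Ideal.span (BraidedLine.syzygies I) ∧
      RingHom.ker (BraidedLine.g h I) = RingHom.ker (BraidedLine.g 0 I) :=
  ⟨BraidedLine.ker_g_eq_span h I,
    (BraidedLine.ker_g_eq_span h I).trans (BraidedLine.ker_g_eq_span 0 I).symm⟩
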